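/- Let $N,M\ge 1$. Let $\mathcal G_1,\dots,\mathcal G_M$ be weighted directed graphs on the nodes $\{1,\dots,N\}$ with nonnegative adjacency matrices $A_\ell=[a^{\ell}_{ik}]$ ($a^\ell_{ik}>0$ exactly when $(k,i)$ is an edge of $\mathcal G_\ell$) and Laplacians $L_\ell=\mathrm{diag}\big(\sum_k a^\ell_{ik}\big)_i-A_\ell$. A graph is strongly connected if there is a directed path between any two distinct nodes of it. A basis bicomponent of $\mathcal G_\ell$ is a (nonempty) strongly connected induced subgraph that receives no edge from the other nodes of $\mathcal G_\ell$. Let $0=t_1<t_2<\cdots$ be switching times and $\bar n:\{1,2,\dots\}\to\{1,\dots,M\}$ a map such that $\mathcal G_{\bar n(j)}$ is the active graph on $[t_j,t_{j+1})$; write $a_{ik}(t)$ for its weights and $L(t)$ for its Laplacian. Assume: (a) the graphs have a jointly strongly connected basis: the union of all basis bicomponents of all $\mathcal G_\ell$ is a strongly connected graph whose vertices are all of $\{1,\dots,N\}$; (b) there is $\tau_{\min}>0$ with $t_{j+1}-t_j>\tau_{\min}$ for all $j\ge 1$; (c) there is $\tau_{\max}>0$ such that for each $\ell$ there are activation and deactivation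 times $T^a_{\ell 1}<T^d_{\ell 1}\le T^a_{\ell 2}<T^d_{\ell 2}\le\cdots$ in $\{t_j\}_{j\ge 1}$ with $L(t)=L_\ell$ for $t\in[T^a_{\ell\nu},T^d_{\ell\nu})$ and $T^a_{\ell,\nu+1}-T^d_{\ell\nu}\le\tau_{\max}$ for all $\nu\ge 1$. Consider the agents $\dot x_i=b_iu_i$, $i=1,\dots,N$, with real constants $b_i\ne 0$ (unknown, possibly of different signs). Let $\lambda_1,\lambda_2>0$ and $$e_i(t)=\sum_{k=1}^N a_{ik}(t)\,\big(x_i(t)-x_k(t)\big),$$ $$S_i(t)=\frac{x_i(t)^2}{2}+\lambda_1\int_0^t x_i(s)^2e_i(s)^2\,ds+\frac{\lambda_2}{2}\Big[\int_0^t x_i(s)e_i(s)\,ds\Big]^2,$$ $$u_i(t)=S_i(t)\cos\big(S_i(t)\big)\,e_i(t)\Big[\lambda_1x_i(t)e_i(t)+\lambda_2\int_0^t x_i(s)e_i(s)\,ds\Big].$$ By a solution of the closed loop on $[0,T)$, $0<T\le\infty$, we mean a continuous function $x$ on $[0,T)$ that satisfies $\dot x_i=b_iu_i$ for all $i$ at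 every $t\in(0,T)$ that is not a switching time. Then for every initial state $x(0)\in\mathbb R^N$ the closed loop has a solution on $[0,\infty)$, and every solution on an interval $[0,T)$ with the same initial state is a restriction of it. Moreover, along this solution all $x_i$ and $u_i$ are bounded on $[0,\infty)$, and $\lim_{t\to\infty}\big(x_i(t)-x_k(t)\big)=0$ for all $i,k\in\{1,\dots,N\}$. -/

import Mathlib

open Set Filter Topology

noncomputable section

/-- A weighted directed graph on the nodes `Fin N`, given by its adjacency matrix `A`.
There is an edge from `k` to `i` exactly when `0 < A i k`. -/
structure WeightedDigraph (N : ℕ) where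
  A : Matrix (Fin N) (Fin N) ℝ
  nonneg : ∀ i k, 0 ≤ A i k

/-- `G.Edge k i`: node `i` receives information from node `k`. -/
def WeightedDigraph.Edge {N : ℕ} (G : WeightedDigraph N) (k i : Fin N) : Prop :=
  0 < G.A i k

/-- The Laplacian `D - A`, where `D` is the diagonal matrix of the in-degrees. -/
def WeightedDigraph.laplacian {N : ℕ} (G : WeightedDigraph N) : Matrix (Fin N) (Fin N) ℝ :=
  Matrix.diagonal (fun i => ∑ k, G.A i k) - G.A

/-- The directed graph with vertex set `S` and those edges of `E` that join vertices of `S` is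
strongly connected: there is a directed path in it between any two distinct vertices. -/
def StronglyConnectedOn {V : Type*} (S : Set V) (E : V → V → Prop) : Prop :=
  ∀ u ∈ S, ∀ v ∈ S, u ≠ v → Relation.TransGen (fun p q => p ∈ S ∧ q ∈ S ∧ E p q) u v

/-- `S` is the vertex set of a basis bicomponent of `G`: the subgraph induced on `S` is strongly
connected and receives no link from a node outside `S`. -/
structure WeightedDigraph.IsBasisBicomponent {N : ℕ} (G : WeightedDigraph N)
    (S : Set (Fin N)) : Prop where
  nonempty : S.Nonempty
  stronglyConnected : StronglyConnectedOn S G.Edge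
  no_incoming : ∀ k, k ∉ S → ∀ i ∈ S, ¬ G.Edge k i

/-- The vertices of the union of all basis bicomponents of all the graphs `G ℓ`. -/
def basisUnionVertices {N M : ℕ} (G : Fin M → WeightedDigraph N) : Set (Fin N) :=
  {v | ∃ ℓ S, (G ℓ).IsBasisBicomponent S ∧ v ∈ S}

/-- The edges of the union of all basis bicomponents of all the graphs `G ℓ`. -/
def basisUnionEdge {N M : ℕ} (G : Fin M → WeightedDigraph N) (k i : Fin N) : Prop :=
  ∃ ℓ S, (G ℓ).IsBasisBicomponent S ∧ k ∈ S ∧ i ∈ S ∧ (G ℓ).Edge k i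

/-- The union of all basis bicomponents is a strongly connected graph on all the nodes. -/
structure HasJointlyStronglyConnectedBasis {N M : ℕ} (G : Fin M → WeightedDigraph N) : Prop where
  vertices : basisUnionVertices G = univ
  stronglyConnected : StronglyConnectedOn (basisUnionVertices G) (basisUnionEdge G)

/-- The switching topologies: `G ℓ` are the finitely many graphs, `t 0 = 0 < t 1 < t 2 < ⋯` the
switching times, `n j` the index of the graph that is active on `[t j, t (j + 1))`, and `Gt s` the
graph that is active at time `s`. Every graph `G ℓ` has a sequence of activation times `Ta ν` and
deactivation times `Td ν` among the switching times and is reactivated within `τmax`. -/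
structure SwitchingTopologies {N M : ℕ} (G : Fin M → WeightedDigraph N) (t : ℕ → ℝ)
    (n : ℕ → Fin M) (Gt : ℝ → WeightedDigraph N) : Prop where
  start : t 0 = 0
  active : ∀ j, ∀ s ∈ Ico (t j) (t (j + 1)), Gt s = G (n j)
  basis : HasJointlyStronglyConnectedBasis G
  dwell : ∃ τmin : ℝ, 0 < τmin ∧ ∀ j, τmin < t (j + 1) - t j
  reactivation : ∃ τmax : ℝ, 0 < τmax ∧ ∀ ℓ, ∃ Ta Td : ℕ → ℝ,
    (∀ ν, Ta ν ∈ range t) ∧ (∀ ν, Td ν ∈ range t) ∧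
    (∀ ν, Ta ν < Td ν) ∧ (∀ ν, Td ν ≤ Ta (ν + 1)) ∧
    (∀ ν, ∀ s ∈ Ico (Ta ν) (Td ν), (Gt s).laplacian = (G ℓ).laplacian) ∧
    (∀ ν, Ta (ν + 1) - Td ν ≤ τmax)

/-- The signal `e_i(t) = ∑ₖ a_ik(t) (x_i(t) - x_k(t))`. -/
def relErr {N : ℕ} (Gt : ℝ → WeightedDigraph N) (x : ℝ → Fin N → ℝ) (i : Fin N) (t : ℝ) : ℝ :=
  ∑ k, (Gt t).A i k * (x t i - x t k)

/-- The nonlinear PI term `S_i(t)`. -/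
def piTerm {N : ℕ} (Gt : ℝ → WeightedDigraph N) (lam1 lam2 : ℝ) (x : ℝ → Fin N → ℝ)
    (i : Fin N) (t : ℝ) : ℝ :=
  x t i ^ 2 / 2 + lam1 * (∫ s in (0 : ℝ)..t, x s i ^ 2 * relErr Gt x i s ^ 2)
    + lam2 / 2 * (∫ s in (0 : ℝ)..t, x s i * relErr Gt x i s) ^ 2

/-- The control input `u_i(t)` along the trajectory `x`. -/
def controlInput {N : ℕ} (Gt : ℝ → WeightedDigraph N) (lam1 lam2 : ℝ) (x : ℝ → Fin N → ℝ)
    (i : Fin N) (t : ℝ) : ℝ :=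
  piTerm Gt lam1 lam2 x i t * Real.cos (piTerm Gt lam1 lam2 x i t) * relErr Gt x i t
    * (lam1 * (x t i * relErr Gt x i t) + lam2 * ∫ s in (0 : ℝ)..t, x s i * relErr Gt x i s)

/-- `x` solves the closed loop `x_i' = b_i u_i` on the time interval `I`: it is continuous on `I`
and satisfies the differential equation at every interior time that is not a switching time. -/
structure IsClosedLoopSolution {N : ℕ} (Gt : ℝ → WeightedDigraph N) (t : ℕ → ℝ) (b : Fin N → ℝ)
    (lam1 lam2 : ℝ) (I : Set ℝ) (x : ℝ → Fin N → ℝ) : Prop where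
  continuousOn : ContinuousOn x I
  hasDerivAt : ∀ s ∈ interior I, s ∉ range t → ∀ i,
    HasDerivAt (fun r => x r i) (b i * controlInput Gt lam1 lam2 x i s) s

end

/-! Adjoin the integrals of `x_i² e_i²` and `x_i e_i` to the state of each agent. The closed loop
becomes a switched ODE with C¹ vector fields, and `S_i` becomes a function of the state with `S_i' =
(b_i S_i cos S_i + 1) · x_i e_i (λ₁ x_i e_i + λ₂ ∫ x_i e_i)` (`IsLoopTrajectory.hasDerivAt_loopPI`).
Whatever the sign of `b_i`, the first factor has arbitrarily large zeros, and `S_i` cannot reach a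
zero above its initial value (`lt_of_hasDerivAt_mul_off_finite`). All three terms of `S_i` are
nonnegative, so the whole state is bounded. The same bound holds when the field is multiplied by a
cutoff with values in `[0, 1]`; a cutoff equal to 1 on the ball given by the bound therefore yields
a global solution.

For consensus, the bounded integral of `x_i² e_i²` and the dwell time give `x_i e_i → 0` by a
Barbalat argument. Since `x_i x_i'` is a bounded multiple of `x_i e_i`, each `x_i` is asymptotically
constant on windows of fixed length. Every graph recurs within such a window, so a limit point `c`
of `x` satisfies `c_i (L_ℓ c)_i = 0` for all `ℓ` and `i`. A positive maximum of `c` then spreads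
backwards along the edges of the strongly connected union, and symmetrically for a negative minimum;
hence `c` is constant. -/

/-! ### Calculus with finitely many exceptional times -/

theorem le_of_deriv_nonneg_off_finset {f f' : ℝ → ℝ} (F : Finset ℝ) :
    ∀ {a b : ℝ}, a ≤ b → ContinuousOn f (Icc a b) →
      (∀ s ∈ Ioo a b, s ∉ F → HasDerivAt f (f' s) s ∧ 0 ≤ f' s) → f a ≤ f b := by
  induction F using Finset.induction_on with
  | empty =>
    intro a b hab hc hd
    refine (monotoneOn_of_hasDerivWithinAt_nonneg (f' := f') (convex_Icc a b) hc ?_ ?_)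
      (left_mem_Icc.2 hab) (right_mem_Icc.2 hab) hab
    · intro s hs
      rw [interior_Icc] at hs ⊢
      exact (hd s hs (by simp)).1.hasDerivWithinAt
    · intro s hs
      rw [interior_Icc] at hs
      exact (hd s hs (by simp)).2
  | insert p F hp ih =>
    intro a b hab hc hd
    by_cases hpm : p ∈ Ioo a b
    · refine (ih hpm.1.le (hc.mono (Icc_subset_Icc_right hpm.2.le)) fun s hs hsF => ?_).trans
        (ih hpm.2.le (hc.mono (Icc_subset_Icc_left hpm.1.le)) fun s hs hsF => ?_)
      · exact hd s ⟨hs.1, hs.2.trans hpm.2⟩ (by simp [hsF, hs.2.ne])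
      · exact hd s ⟨hpm.1.trans hs.1, hs.2⟩ (by simp [hsF, hs.1.ne'])
    · refine ih hab hc fun s hs hsF => hd s hs ?_
      have : s ≠ p := fun h => hpm (h ▸ hs)
      simp [hsF, this]

/-- A continuous function whose derivative is nonnegative off a finite set is monotone. -/
theorem le_of_deriv_nonneg_off_finite {f f' : ℝ → ℝ} {D : Set ℝ} {a b : ℝ} (hab : a ≤ b)
    (hD : (D ∩ Ioo a b).Finite) (hc : ContinuousOn f (Icc a b))
    (hd : ∀ s ∈ Ioo a b, s ∉ D → HasDerivAt f (f' s) s) (h0 : ∀ s ∈ Ioo a b, s ∉ D → 0 ≤ f' s) :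
    f a ≤ f b := by
  refine le_of_deriv_nonneg_off_finset (f' := f') hD.toFinset hab hc fun s hs hsF => ?_
  have : s ∉ D := fun h => hsF (by simpa using ⟨h, hs⟩)
  exact ⟨hd s hs this, h0 s hs this⟩

theorem abs_sub_le_of_abs_deriv_le_off_finite {f f' : ℝ → ℝ} {D : Set ℝ} {a b C : ℝ} (hab : a ≤ b)
    (hD : (D ∩ Ioo a b).Finite) (hc : ContinuousOn f (Icc a b))
    (hd : ∀ s ∈ Ioo a b, s ∉ D → HasDerivAt f (f' s) s)
    (hC : ∀ s ∈ Ioo a b, s ∉ D → |f' s| ≤ C) : |f b - f a| ≤ C * (b - a) := by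
  have h1 := le_of_deriv_nonneg_off_finite (f := fun s => C * s - f s) (f' := fun s => C - f' s)
    hab hD (by fun_prop) (fun s hs hsD => by
      simpa using ((hasDerivAt_id s).const_mul C).fun_sub (hd s hs hsD))
    (fun s hs hsD => by linarith [(abs_le.1 (hC s hs hsD)).2])
  have h2 := le_of_deriv_nonneg_off_finite (f := fun s => C * s + f s) (f' := fun s => C + f' s)
    hab hD (by fun_prop) (fun s hs hsD => by
      simpa using ((hasDerivAt_id s).const_mul C).fun_add (hd s hs hsD))
    (fun s hs hsD => by linarith [(abs_le.1 (hC s hs hsD)).1])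
  rw [abs_le]
  constructor <;> linarith

/-- Grönwall's inequality with finitely many exceptional times. -/
theorem mul_exp_le_of_deriv_ge_off_finite {V V' : ℝ → ℝ} {D : Set ℝ} {a b c : ℝ} (hab : a ≤ b)
    (hD : (D ∩ Ioo a b).Finite) (hc : ContinuousOn V (Icc a b))
    (hd : ∀ s ∈ Ioo a b, s ∉ D → HasDerivAt V (V' s) s)
    (hV : ∀ s ∈ Ioo a b, s ∉ D → -(c * V s) ≤ V' s) :
    V a * Real.exp (c * a) ≤ V b * Real.exp (c * b) := by
  refine le_of_deriv_nonneg_off_finite (f := fun s => V s * Real.exp (c * s))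
    (f' := fun s => V' s * Real.exp (c * s) + V s * (Real.exp (c * s) * c)) hab hD
    (hc.mul (by fun_prop)) (fun s hs hsD => ?_) (fun s hs hsD => ?_)
  · refine (hd s hs hsD).mul (HasDerivAt.exp ?_)
    simpa using (hasDerivAt_id s).const_mul c
  · have := hV s hs hsD
    have h2 := Real.exp_pos (c * s)
    have : 0 ≤ (V' s + c * V s) * Real.exp (c * s) := mul_nonneg (by linarith) h2.le
    linarith

/-- Two solutions of an ordinary differential equation with finitely many switching times that
start at the same point coincide. -/
theorem eq_of_hasDerivAt_off_finite {E : Type*} [NormedAddCommGroup E] [InnerProductSpace ℝ E]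
    {z w z' w' : ℝ → E} {D : Set ℝ} {a b K : ℝ} (hab : a ≤ b) (hD : (D ∩ Ioo a b).Finite)
    (hz : ContinuousOn z (Icc a b)) (hw : ContinuousOn w (Icc a b))
    (hz' : ∀ s ∈ Ioo a b, s ∉ D → HasDerivAt z (z' s) s)
    (hw' : ∀ s ∈ Ioo a b, s ∉ D → HasDerivAt w (w' s) s)
    (hK : ∀ s ∈ Ioo a b, s ∉ D → ‖z' s - w' s‖ ≤ K * ‖z s - w s‖) (h0 : z a = w a) :
    z b = w b := by
  -- The sign turns the upper bound on the growth of the squared distance into the lower bound on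
  -- `V'` that Grönwall needs.
  have h := mul_exp_le_of_deriv_ge_off_finite (V := fun s => -‖z s - w s‖ ^ 2)
    (V' := fun s => -(2 * inner ℝ (z s - w s) (z' s - w' s))) (c := -(2 * K)) hab hD
    (((hz.sub hw).norm.pow 2).neg)
    (fun s hs hsD => (((hz' s hs hsD).sub (hw' s hs hsD)).norm_sq).neg)
    (fun s hs hsD => by
      have h1 := real_inner_le_norm (z s - w s) (z' s - w' s)
      have h2 := mul_le_mul_of_nonneg_left (hK s hs hsD) (norm_nonneg (z s - w s))
      nlinarith)
  simp only [h0, sub_self, norm_zero] at h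
  have h3 := Real.exp_pos (-(2 * K) * b)
  have h4 : ‖z b - w b‖ ^ 2 ≤ 0 := by
    by_contra! h5
    nlinarith
  have : ‖z b - w b‖ = 0 := by nlinarith [norm_nonneg (z b - w b)]
  exact sub_eq_zero.1 (norm_eq_zero.1 this)

/-- A solution of `S' = g(S) w` that starts below a zero of `g` stays below it. -/
theorem lt_of_hasDerivAt_mul_off_finite {S w g : ℝ → ℝ} {D : Set ℝ} {a b c W : ℝ} (hab : a ≤ b)
    (hD : (D ∩ Ioo a b).Finite) (hg : ContDiff ℝ 1 g) (hgc : g c = 0)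
    (hS : ContinuousOn S (Icc a b)) (hS' : ∀ s ∈ Ioo a b, s ∉ D → HasDerivAt S (g (S s) * w s) s)
    (hw : ∀ s ∈ Ioo a b, s ∉ D → |w s| ≤ W) (h0 : S a < c) : S b < c := by
  by_contra! hb
  obtain ⟨r, hr, hrc⟩ : c ∈ S '' Icc a b := intermediate_value_Icc hab hS ⟨h0.le, hb⟩
  obtain ⟨R, hR⟩ := ((isCompact_Icc.image_of_continuousOn hS).isBounded.subset_closedBall 0)
  have hmem : ∀ s ∈ Icc a b, S s ∈ Metric.closedBall (0 : ℝ) R := fun s hs =>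
    hR (mem_image_of_mem S hs)
  obtain ⟨K, hK⟩ := (hg.contDiffOn (s := Metric.closedBall (0 : ℝ) R)).locallyLipschitzOn
    (convex_closedBall 0 R) |>.exists_lipschitzOnWith_of_compact (isCompact_closedBall 0 R)
  have hcm : c ∈ Metric.closedBall (0 : ℝ) R := hrc ▸ hmem r hr
  have hsub : Ioo a r ⊆ Ioo a b := Ioo_subset_Ioo_right hr.2
  have hsub' : Icc a r ⊆ Icc a b := Icc_subset_Icc_right hr.2
  have hW0 : a < r := lt_of_le_of_ne hr.1 (by rintro rfl; exact h0.ne hrc)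
  -- Since `g c = 0`, `|g (S s)| ≤ K |S s - c|`, so `(S - c)²` decays at most exponentially and
  -- cannot vanish at `r`.
  have h := mul_exp_le_of_deriv_ge_off_finite (V := fun s => (S s - c) ^ 2)
    (V' := fun s => 2 * (S s - c) * (g (S s) * w s)) (c := 2 * (K * W)) hr.1
    (hD.subset (inter_subset_inter_right _ hsub))
    (((hS.mono hsub').sub continuousOn_const).pow 2)
    (fun s hs hsD => by
      have := ((hS' s (hsub hs) hsD).sub_const c).pow 2
      refine this.congr_deriv ?_
      simp)
    (fun s hs hsD => by
      have h1 := hK.dist_le_mul (S s) (hmem s (hsub' (Ioo_subset_Icc_self hs))) c hcm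
      rw [Real.dist_eq, Real.dist_eq, hgc, sub_zero] at h1
      have h2 : |(S s - c) * (g (S s) * w s)| ≤ K * W * (S s - c) ^ 2 := by
        rw [abs_mul, abs_mul, ← sq_abs (S s - c)]
        have h3 := mul_le_mul h1 (hw s (hsub hs) hsD) (abs_nonneg _) (by positivity)
        have := mul_le_mul_of_nonneg_left h3 (abs_nonneg (S s - c))
        linarith
      have := (abs_le.1 h2).1
      linarith)
  simp only [hrc, sub_self] at h
  have h3 := Real.exp_pos (2 * (K * W) * a)
  have h5 : 0 < (S a - c) ^ 2 := by
    have : S a - c ≠ 0 := by linarith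
    positivity
  nlinarith [mul_pos h5 h3]

/-- The gain `b s cos s + 1` has arbitrarily large zeros. -/
theorem exists_gt_mul_cos_eq_zero {b : ℝ} (hb : b ≠ 0) (m : ℝ) :
    ∃ c, m < c ∧ b * (c * Real.cos c) + 1 = 0 := by
  obtain ⟨k, hk⟩ := exists_nat_gt (max m (1 / |b|))
  have hkm : m < k := (le_max_left _ _).trans_lt hk
  have hb0 : 0 < |b| := abs_pos.2 hb
  have hkb : 1 < k * |b| := by
    have := (le_max_right _ _).trans_lt hk
    rwa [div_lt_iff₀ hb0] at this
  have hpi := Real.pi_gt_three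
  have hk0 : (0 : ℝ) ≤ k := k.cast_nonneg
  -- The cosine is `1` at `p` and `-1` at `p + π`; as `k |b| > 1`, the gain changes sign between
  -- them.
  set p : ℝ := k * (2 * Real.pi) with hp
  have hpk : (k : ℝ) ≤ p := by rw [hp]; nlinarith
  have hcont : ContinuousOn (fun c => b * (c * Real.cos c) + 1) (Icc p (p + Real.pi)) := by
    fun_prop
  have h1 : Real.cos p = 1 := Real.cos_nat_mul_two_pi k
  have h2 : Real.cos (p + Real.pi) = -1 := by rw [Real.cos_add_pi, h1]
  have hle : p ≤ p + Real.pi := by linarith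
  have key : (0 : ℝ) ∈ (fun c => b * (c * Real.cos c) + 1) '' Icc p (p + Real.pi) := by
    rcases lt_or_gt_of_ne hb with hneg | hpos
    · rw [abs_of_neg hneg] at hkb
      refine intermediate_value_Icc hle hcont ⟨?_, ?_⟩
      · simp only [h1]; nlinarith
      · simp only [h2]; nlinarith
    · rw [abs_of_pos hpos] at hkb
      refine intermediate_value_Icc' hle hcont ⟨?_, ?_⟩
      · simp only [h2]; nlinarith
      · simp only [h1]; nlinarith
  obtain ⟨c, hc, hc0⟩ := key
  exact ⟨c, by linarith [hc.1], hc0⟩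

/-! ### Dwell time: Barbalat's lemma and global switched solutions -/

section Dwell

variable {t : ℕ → ℝ} {τ : ℝ}

theorem strictMono_of_dwell (hτ : 0 < τ) (ht : ∀ j, τ < t (j + 1) - t j) : StrictMono t :=
  strictMono_nat_of_lt_succ fun j => by linarith [ht j]

theorem tendsto_atTop_of_dwell (hτ : 0 < τ) (ht : ∀ j, τ < t (j + 1) - t j) :
    Tendsto t atTop atTop := by
  have h : ∀ j : ℕ, t 0 + j * τ ≤ t j := by
    intro j
    induction j with
    | zero => simp
    | succ j ih => push_cast; linarith [ht j]
  refine tendsto_atTop_mono h (tendsto_atTop_add_const_left _ _ ?_)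
  exact tendsto_natCast_atTop_atTop.atTop_mul_const hτ

theorem exists_mem_Ico_of_tendsto_atTop (ht : Tendsto t atTop atTop) {s : ℝ} (hs : t 0 ≤ s) :
    ∃ j, s ∈ Ico (t j) (t (j + 1)) := by
  classical
  have hex : ∃ j, s < t j := (ht.eventually_gt_atTop s).exists
  obtain ⟨j, hj⟩ : ∃ j, Nat.find hex = j + 1 := by
    refine Nat.exists_eq_succ_of_ne_zero fun h => ?_
    have := Nat.find_spec hex
    rw [h] at this
    exact this.not_ge hs
  refine ⟨j, ?_, hj ▸ Nat.find_spec hex⟩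
  exact not_lt.1 (Nat.find_min hex (by omega))

theorem finite_range_inter_Ioo (ht : Tendsto t atTop atTop) (a b : ℝ) :
    (range t ∩ Ioo a b).Finite := by
  obtain ⟨m, hm⟩ := (ht.eventually_ge_atTop b).exists_forall_of_atTop
  refine ((finite_Iio m).image t).subset ?_
  rintro _ ⟨⟨j, rfl⟩, hj⟩
  exact ⟨j, not_le.1 fun h => (hm j h).not_gt hj.2, rfl⟩

/-- A variant of Barbalat's lemma: a square integrable function that is uniformly Lipschitz between
the switching times tends to zero. -/
theorem tendsto_zero_of_bounded_primitive_sq (ht0 : t 0 = 0) (hτ : 0 < τ)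
    (ht : ∀ j, τ < t (j + 1) - t j) {f η : ℝ → ℝ} {K C : ℝ} (hK : 0 < K)
    (hf : ∀ j, ∀ r ∈ Ico (t j) (t (j + 1)), ∀ s ∈ Ico (t j) (t (j + 1)), |f r - f s| ≤ K * |r - s|)
    (hη : ContinuousOn η (Ici 0))
    (hη' : ∀ s, 0 < s → s ∉ range t → HasDerivAt η (f s ^ 2) s) (hC : ∀ s, 0 ≤ s → η s ≤ C) :
    Tendsto f atTop (𝓝 0) := by
  have htop := tendsto_atTop_of_dwell hτ ht
  have hgrow : ∀ m p q, 0 ≤ p → p ≤ q → (∀ r ∈ Ioo p q, m ≤ f r ^ 2) →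
      m * (q - p) ≤ η q - η p := by
    intro m p q hp hpq hm
    have := le_of_deriv_nonneg_off_finite (f := fun r => η r - m * r)
      (f' := fun r => f r ^ 2 - m) hpq (finite_range_inter_Ioo htop p q)
      ((hη.mono fun r hr => hp.trans hr.1).sub (by fun_prop))
      (fun s hs hsD => by
        simpa using (hη' s (hp.trans_lt hs.1) hsD).fun_sub ((hasDerivAt_id s).const_mul m))
      (fun s hs _ => by linarith [hm s hs])
    linarith
  have hmono : ∀ p q, 0 ≤ p → p ≤ q → η p ≤ η q := fun p q hp hpq => by
    have := hgrow 0 p q hp hpq fun r _ => sq_nonneg _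
    linarith
  obtain ⟨L, hL⟩ : ∃ L, Tendsto η atTop (𝓝 L) := by
    have hm : Monotone fun s => η (max s 0) := fun p q hpq =>
      hmono _ _ (le_max_right _ _) (max_le_max_right 0 hpq)
    refine ⟨_, (tendsto_atTop_ciSup hm ⟨C, ?_⟩).congr' ?_⟩
    · rintro _ ⟨s, rfl⟩
      exact hC _ (le_max_right _ _)
    · filter_upwards [eventually_ge_atTop 0] with s hs
      rw [max_eq_left hs]
  rw [Metric.tendsto_nhds]
  intro ε hε
  -- With `δ ≤ τ / 2`, one of `[s - δ, s]` and `[s, s + δ]` lies in a single switching interval;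
  -- with `K δ ≤ ε / 2`, `|f| ≥ ε / 2` on it, so `η` grows there by at least `ε² δ / 4`.
  set δ := min (τ / 2) (ε / (2 * K)) with hδ
  have hδ0 : 0 < δ := by positivity
  have hδτ : δ ≤ τ / 2 := min_le_left _ _
  have hδK : K * δ ≤ ε / 2 := by
    have : δ ≤ ε / (2 * K) := min_le_right _ _
    rw [le_div_iff₀ (by positivity)] at this
    linarith
  have hdiff : Tendsto (fun s => η (s + δ) - η (s - δ)) atTop (𝓝 0) := by
    have h1 := hL.comp (tendsto_atTop_add_const_right atTop δ tendsto_id)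
    have h2 := hL.comp (tendsto_atTop_add_const_right atTop (-δ) tendsto_id)
    simpa [Function.comp_def, sub_eq_add_neg] using h1.sub h2
  have hpos : 0 < ε ^ 2 / 4 * δ := by positivity
  filter_upwards [hdiff.eventually_lt_const hpos, eventually_ge_atTop δ] with s hs hsδ
  rw [Real.dist_eq, sub_zero]
  by_contra! hfs
  obtain ⟨j, hj⟩ := exists_mem_Ico_of_tendsto_atTop htop (s := s) (by linarith)
  have key : ∀ p, s - δ ≤ p → p ≤ s → t j ≤ p → p + δ < t (j + 1) → False := by
    intro p hp1 hp2 hp3 hp4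
    have h1 := hgrow (ε ^ 2 / 4) p (p + δ) (by linarith) (by linarith) fun r hr => by
      have h2 := hf j r ⟨hp3.trans hr.1.le, hr.2.trans hp4⟩ s hj
      have h3 : |r - s| ≤ δ := abs_le.2 ⟨by linarith [hr.1], by linarith [hr.2]⟩
      have h4 := abs_sub_abs_le_abs_sub (f s) (f r)
      rw [abs_sub_comm (f s)] at h4
      have h5 : ε / 2 ≤ |f r| := by nlinarith
      rw [← sq_abs (f r)]
      nlinarith
    have h6 := hmono (s - δ) p (by linarith) hp1
    have h7 := hmono (p + δ) (s + δ) (by linarith) (by linarith)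
    rw [add_sub_cancel_left] at h1
    linarith
  by_cases hcase : s + δ < t (j + 1)
  · exact key s (by linarith) le_rfl hj.1 hcase
  · have := ht j
    refine key (s - δ) le_rfl (by linarith) (by linarith) (by linarith [hj.2])

/-- Global solutions of switched ordinary differential equations whose vector fields are bounded
and Lipschitz. -/
theorem exists_switched_solution {E : Type*} [NormedAddCommGroup E] [NormedSpace ℝ E]
    [CompleteSpace E] (hmono : StrictMono t) (htop : Tendsto t atTop atTop) {f : ℕ → E → E}
    (hL : ∀ j, ∃ L, ∀ z, ‖f j z‖ ≤ L) (hK : ∀ j, ∃ K, LipschitzWith K (f j)) (z₀ : E) :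
    ∃ z : ℝ → E, ContinuousOn z (Ici (t 0)) ∧ z (t 0) = z₀ ∧
      ∀ j, ∀ s ∈ Ioo (t j) (t (j + 1)), HasDerivAt z (f j (z s)) s := by
  have hlt : ∀ j, t j < t (j + 1) := fun j => hmono j.lt_succ_self
  have hpiece : ∀ j (v : E), ∃ α : ℝ → E, α (t j) = v ∧ ∀ s ∈ Icc (t j) (t (j + 1)),
      HasDerivWithinAt α (f j (α s)) (Icc (t j) (t (j + 1))) s := by
    intro j v
    obtain ⟨L, hL⟩ := hL j
    obtain ⟨K, hK⟩ := hK j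
    have hL0 : 0 ≤ L := (norm_nonneg _).trans (hL v)
    lift L to NNReal using hL0
    have hd : 0 ≤ t (j + 1) - t j := sub_nonneg.2 (hlt j).le
    -- The global bound `L` keeps the solution within `L` times the interval length of `v`, so it
    -- exists on the whole interval.
    refine (IsPicardLindelof.of_time_independent (f := f j)
      (t₀ := ⟨t j, left_mem_Icc.2 (hlt j).le⟩) (x₀ := v) (a := L * ⟨_, hd⟩) (r := 0) (L := L)
      (K := K) (fun z _ => hL z) hK.lipschitzOnWith
      ?_).exists_eq_forall_mem_Icc_hasDerivWithinAt₀
    simp only [NNReal.coe_zero, sub_zero, sub_self, max_eq_left hd]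
    exact le_rfl
  choose φ hφ0 hφ using hpiece
  let v : ℕ → E := fun j => Nat.rec z₀ (fun j v => φ j v (t (j + 1))) j
  have hvs : ∀ j, v (j + 1) = φ j (v j) (t (j + 1)) := fun j => rfl
  have hex : ∀ s, ∃ j, t 0 ≤ s → s ∈ Ico (t j) (t (j + 1)) := fun s => by
    by_cases hs : t 0 ≤ s
    · obtain ⟨j, hj⟩ := exists_mem_Ico_of_tendsto_atTop htop hs
      exact ⟨j, fun _ => hj⟩
    · exact ⟨0, fun h => absurd h hs⟩
  choose J hJ using hex
  have hJeq : ∀ j, ∀ s ∈ Ico (t j) (t (j + 1)), J s = j := by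
    intro j s hs
    have h := hJ s ((hmono.monotone j.zero_le).trans hs.1)
    have h1 := hmono.lt_iff_lt.1 (h.1.trans_lt hs.2)
    have h2 := hmono.lt_iff_lt.1 (hs.1.trans_lt h.2)
    omega
  let z : ℝ → E := fun s => φ (J s) (v (J s)) s
  -- At the right endpoint `z` already uses the next piece, whose initial value is the end value of
  -- this one.
  have hz : ∀ j, ∀ s ∈ Icc (t j) (t (j + 1)), z s = φ j (v j) s := by
    intro j s hs
    rcases hs.2.eq_or_lt with rfl | h
    · have : J (t (j + 1)) = j + 1 := hJeq _ _ ⟨le_rfl, hlt _⟩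
      simp only [z, this]
      rw [hφ0, hvs]
    · simp only [z, hJeq j s ⟨hs.1, h⟩]
  have hzd : ∀ j, ∀ s ∈ Icc (t j) (t (j + 1)),
      HasDerivWithinAt z (f j (z s)) (Icc (t j) (t (j + 1))) s := by
    intro j s hs
    rw [hz j s hs]
    exact (hφ j (v j) s hs).congr (hz j) (hz j s hs)
  have hzc : ∀ j, ContinuousOn z (Icc (t 0) (t j)) := by
    intro j
    induction j with
    | zero => simp
    | succ j ih =>
      rw [← Icc_union_Icc_eq_Icc (hmono.monotone j.zero_le) (hlt j).le]
      exact ih.union_of_isClosed (fun s hs => (hzd j s hs).continuousWithinAt) isClosed_Icc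
        isClosed_Icc
  refine ⟨z, fun s hs => ?_, ?_, fun j s hs => ?_⟩
  · obtain ⟨j, hj⟩ := exists_mem_Ico_of_tendsto_atTop htop hs
    refine (hzc (j + 1) s ⟨hs, hj.2.le⟩).mono_of_mem_nhdsWithin ?_
    rw [← Ici_inter_Iic]
    exact inter_mem self_mem_nhdsWithin (mem_nhdsWithin_of_mem_nhds (Iic_mem_nhds hj.2))
  · exact (hz 0 (t 0) ⟨le_rfl, (hlt 0).le⟩).trans (hφ0 0 z₀)
  · exact (hzd j s (Ioo_subset_Icc_self hs)).hasDerivAt (Icc_mem_nhds hs.1 hs.2)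

end Dwell

/-! ### Equilibria common to all graphs -/

section Graph

variable {N M : ℕ}

/-- If the states `c i` satisfy `c i * (L_ℓ c) i = 0` and their maximum is positive, then they
agree. -/
theorem HasJointlyStronglyConnectedBasis.eq_of_pos {G : Fin M → WeightedDigraph N}
    (hG : HasJointlyStronglyConnectedBasis G) {c : Fin N → ℝ}
    (hc : ∀ ℓ i, c i * ∑ k, (G ℓ).A i k * (c i - c k) = 0) {m : Fin N} (hm : ∀ i, c i ≤ c m)
    (hpos : 0 < c m) (u : Fin N) : c u = c m := by
  have hback : ∀ p q, basisUnionEdge G p q → c q = c m → c p = c m := by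
    -- At a node with the positive maximal value the weighted sum vanishes; its terms are
    -- nonnegative, so every in-neighbour has the same value.
    rintro p q ⟨ℓ, S, -, -, -, hedge⟩ hq
    have h0 : ∑ k, (G ℓ).A q k * (c q - c k) = 0 :=
      (mul_eq_zero.1 (hc ℓ q)).resolve_left (hq ▸ hpos.ne')
    have h1 := (Finset.sum_eq_zero_iff_of_nonneg fun k _ =>
      mul_nonneg ((G ℓ).nonneg q k) (by linarith [hm k])).1 h0 p (Finset.mem_univ p)
    have h2 := (mul_eq_zero.1 h1).resolve_left (ne_of_gt hedge)
    linarith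
  by_cases hum : u = m
  · rw [hum]
  have hpath := hG.stronglyConnected u (hG.vertices ▸ mem_univ u) m (hG.vertices ▸ mem_univ m) hum
  induction hpath using Relation.TransGen.head_induction_on with
  | single h => exact hback _ _ h.2.2 rfl
  | @head p q h _ ih =>
    refine hback _ _ h.2.2 ?_
    by_cases hqm : q = m
    · rw [hqm]
    · exact ih hqm

/-- The condition is even in `c`, so a negative minimum is a positive maximum of `-c`. If neither
occurs, `c = 0`. -/
theorem HasJointlyStronglyConnectedBasis.eq_of_mul_eq_zero {G : Fin M → WeightedDigraph N}
    (hG : HasJointlyStronglyConnectedBasis G) {c : Fin N → ℝ}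
    (hc : ∀ ℓ i, c i * ∑ k, (G ℓ).A i k * (c i - c k) = 0) (i k : Fin N) : c i = c k := by
  have : Nonempty (Fin N) := ⟨i⟩
  obtain ⟨p, hp⟩ := Finite.exists_max c
  obtain ⟨q, hq⟩ := Finite.exists_min c
  by_cases hpp : 0 < c p
  · rw [hG.eq_of_pos hc hp hpp i, hG.eq_of_pos hc hp hpp k]
  by_cases hqq : c q < 0
  · have hc' : ∀ ℓ i, (-c) i * ∑ k, (G ℓ).A i k * ((-c) i - (-c) k) = 0 := fun ℓ i => by
      rw [← hc ℓ i]
      simp only [Pi.neg_apply, neg_mul, ← mul_neg, ← Finset.sum_neg_distrib]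
      congr 1
      exact Finset.sum_congr rfl fun k _ => by ring
    have h := hG.eq_of_pos hc' (m := q) (fun i => neg_le_neg (hq i)) (by simpa using hqq)
    have h1 := h i
    have h2 := h k
    simp only [Pi.neg_apply, neg_inj] at h1 h2
    rw [h1, h2]
  · linarith [hp i, hp k, hq i, hq k]

theorem WeightedDigraph.sum_mul_sub_eq_laplacian_mulVec (g : WeightedDigraph N) (c : Fin N → ℝ)
    (i : Fin N) : ∑ k, g.A i k * (c i - c k) = (g.laplacian.mulVec c) i := by
  simp only [WeightedDigraph.laplacian, Matrix.sub_mulVec, Pi.sub_apply, Matrix.mulVec_diagonal]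
  simp only [mul_sub, Finset.sum_sub_distrib, Finset.sum_mul, Matrix.mulVec, dotProduct]

end Graph

/-! ### Recurrence of the graphs and integrals along switched signals -/

namespace SwitchingTopologies

variable {N M : ℕ} {G : Fin M → WeightedDigraph N} {t : ℕ → ℝ} {n : ℕ → Fin M}
  {Gt : ℝ → WeightedDigraph N}

theorem strictMono (hG : SwitchingTopologies G t n Gt) : StrictMono t :=
  let ⟨_, h, ht⟩ := hG.dwell
  strictMono_of_dwell h ht

theorem tendsto_atTop (hG : SwitchingTopologies G t n Gt) : Tendsto t atTop atTop :=
  let ⟨_, h, ht⟩ := hG.dwell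
  tendsto_atTop_of_dwell h ht

theorem exists_mem_Ico (hG : SwitchingTopologies G t n Gt) {s : ℝ} (hs : 0 ≤ s) :
    ∃ j, s ∈ Ico (t j) (t (j + 1)) :=
  exists_mem_Ico_of_tendsto_atTop hG.tendsto_atTop (hG.start.le.trans hs)

theorem exists_mem_Ioo (hG : SwitchingTopologies G t n Gt) {s : ℝ} (hs : 0 ≤ s)
    (hst : s ∉ range t) : ∃ j, s ∈ Ioo (t j) (t (j + 1)) := by
  obtain ⟨j, hj⟩ := hG.exists_mem_Ico hs
  exact ⟨j, lt_of_le_of_ne hj.1 fun h => hst ⟨j, h⟩, hj.2⟩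

theorem nonneg (hG : SwitchingTopologies G t n Gt) (j : ℕ) : 0 ≤ t j :=
  hG.start ▸ hG.strictMono.monotone j.zero_le

theorem exists_eq (hG : SwitchingTopologies G t n Gt) {s : ℝ} (hs : 0 ≤ s) :
    ∃ ℓ, Gt s = G ℓ :=
  let ⟨j, hj⟩ := hG.exists_mem_Ico hs
  ⟨n j, hG.active j s hj⟩

/-- Every graph is active at some time of every late enough window of a fixed length. -/
theorem exists_window (hG : SwitchingTopologies G t n Gt) :
    ∃ W, 0 < W ∧ ∀ ℓ, ∃ s₀, ∀ s, s₀ ≤ s →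
      ∃ r ∈ Icc s (s + W), (Gt r).laplacian = (G ℓ).laplacian := by
  obtain ⟨W, hW, h⟩ := hG.reactivation
  refine ⟨W, hW, fun ℓ => ?_⟩
  obtain ⟨Ta, Td, hTa, -, hlt, hle, hact, hgap⟩ := h ℓ
  refine ⟨Ta 0, fun s hs => ?_⟩
  have hTmono : StrictMono Ta := strictMono_nat_of_lt_succ fun ν => (hlt ν).trans_le (hle ν)
  -- The activation times are strictly increasing switching times, hence a subsequence of `t`.
  have htop : Tendsto Ta atTop atTop := by
    choose k hk using hTa
    have hkm : StrictMono k := fun a b hab => by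
      have := hTmono hab
      rw [← hk a, ← hk b] at this
      exact hG.strictMono.lt_iff_lt.1 this
    exact (hG.tendsto_atTop.comp hkm.tendsto_atTop).congr hk
  obtain ⟨ν, hν⟩ := exists_mem_Ico_of_tendsto_atTop htop hs
  by_cases hd : s < Td ν
  · exact ⟨s, ⟨le_rfl, by linarith⟩, hact ν s ⟨hν.1, hd⟩⟩
  · exact ⟨Ta (ν + 1), ⟨hν.2.le, by linarith [hgap ν]⟩, hact (ν + 1) _ ⟨le_rfl, hlt _⟩⟩

section Integral

open MeasureTheory

variable {V : Type*} [TopologicalSpace V] {Φ : WeightedDigraph N → V → ℝ} {x : ℝ → V} {T : ℝ}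

theorem intervalIntegrable (hG : SwitchingTopologies G t n Gt) (hΦ : ∀ g, Continuous (Φ g))
    (hT : 0 ≤ T) (hx : ContinuousOn x (Icc 0 T)) :
    IntervalIntegrable (fun s => Φ (Gt s) (x s)) volume 0 T := by
  -- The last switching interval may extend beyond `T`, so `x` is continued continuously to apply
  -- continuity on whole intervals.
  set y := IccExtend hT ((Icc 0 T).domRestrict x) with hy
  have hyc : Continuous y := hx.domRestrict.Icc_extend'
  have hpiece : ∀ k, IntervalIntegrable (fun s => Φ (Gt s) (y s)) volume (t k) (t (k + 1)) := by
    intro k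
    refine ((hΦ (G (n k))).comp hyc).intervalIntegrable (t k) (t (k + 1)) |>.congr_uIoo ?_
    intro s hs
    rw [uIoo_of_le (hG.strictMono k.lt_succ_self).le] at hs
    simp [hG.active k s ⟨hs.1.le, hs.2⟩]
  obtain ⟨m, hm⟩ := (hG.tendsto_atTop.eventually_ge_atTop T).exists
  have h := IntervalIntegrable.trans_iterate (a := t) (n := m) fun k _ => hpiece k
  rw [hG.start] at h
  refine (h.mono_set ?_).congr_uIoo ?_
  · rw [uIcc_of_le hT, uIcc_of_le (hT.trans hm)]
    exact Icc_subset_Icc_right hm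
  · intro s hs
    rw [uIoo_of_le hT] at hs
    simp only [hy]
    rw [IccExtend_of_mem hT _ (Ioo_subset_Icc_self hs), domRestrict_apply]

theorem continuousOn_integral (hG : SwitchingTopologies G t n Gt) (hΦ : ∀ g, Continuous (Φ g))
    (hT : 0 ≤ T) (hx : ContinuousOn x (Icc 0 T)) :
    ContinuousOn (fun r => ∫ s in (0 : ℝ)..r, Φ (Gt s) (x s)) (Icc 0 T) := by
  have := intervalIntegral.continuousOn_primitive_interval'
    (hG.intervalIntegrable hΦ hT hx) left_mem_uIcc
  rwa [uIcc_of_le hT] at this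

theorem hasDerivAt_integral (hG : SwitchingTopologies G t n Gt) (hΦ : ∀ g, Continuous (Φ g))
    (hx : ContinuousOn x (Icc 0 T)) {s : ℝ} (hs : s ∈ Ioo 0 T) (hst : s ∉ range t) :
    HasDerivAt (fun r => ∫ s in (0 : ℝ)..r, Φ (Gt s) (x s)) (Φ (Gt s) (x s)) s := by
  obtain ⟨j, hj⟩ := hG.exists_mem_Ioo hs.1.le hst
  have hopen : IsOpen (Ioo (t j) (t (j + 1)) ∩ Ioo 0 T) := isOpen_Ioo.inter isOpen_Ioo
  have hc : ContinuousOn (fun r => Φ (Gt r) (x r)) (Ioo (t j) (t (j + 1)) ∩ Ioo 0 T) := by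
    refine ((hΦ (G (n j))).comp_continuousOn
      (hx.mono (inter_subset_right.trans Ioo_subset_Icc_self))).congr fun r hr => ?_
    simp only [hG.active j r (Ioo_subset_Ico_self hr.1), Function.comp_apply]
  exact intervalIntegral.integral_hasDerivAt_right
    (hG.intervalIntegrable hΦ hs.1.le (hx.mono (Icc_subset_Icc_right hs.2.le)))
    (hc.stronglyMeasurableAtFilter hopen s ⟨hj, hs⟩)
    (hc.continuousAt (hopen.mem_nhds ⟨hj, hs⟩))

end Integral

end SwitchingTopologies

theorem hasDerivAt_euclidean {ι : Type*} [Fintype ι] {z : ℝ → EuclideanSpace ℝ ι}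
    {z' : EuclideanSpace ℝ ι} {s : ℝ} :
    HasDerivAt z z' s ↔ ∀ i, HasDerivAt (fun r => z r i) (z' i) s := by
  simp only [hasDerivAt_iff_hasFDerivAt, ← hasFDerivWithinAt_univ, hasFDerivWithinAt_euclidean]
  refine forall_congr' fun i => ?_
  have : PiLp.proj 2 (fun _ => ℝ) i ∘L ContinuousLinearMap.toSpanSingleton ℝ z' =
      ContinuousLinearMap.toSpanSingleton ℝ (z' i) := by
    ext
    simp
  rw [this]

/-- The state of the closed loop augmented by the two integrals of every agent. -/
abbrev LoopState (N : ℕ) := EuclideanSpace ℝ (Fin N × Fin 3)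

/-! ### The augmented vector field -/

section Field

variable {N : ℕ} (g : WeightedDigraph N) (b : Fin N → ℝ) (lam1 lam2 : ℝ) (z : LoopState N)
  (i : Fin N)

/-- The signal `e_i` at the augmented state `z`. -/
noncomputable def loopErr : ℝ := ∑ k, g.A i k * (z (i, 0) - z (k, 0))

/-- The nonlinear PI term `S_i` at the augmented state `z`. -/
noncomputable def loopPI : ℝ := z (i, 0) ^ 2 / 2 + lam1 * z (i, 1) + lam2 / 2 * z (i, 2) ^ 2

/-- The factor `λ₁ x_i e_i + λ₂ ∫ x_i e_i` of the input. -/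
noncomputable def loopFactor : ℝ := lam1 * (z (i, 0) * loopErr g z i) + lam2 * z (i, 2)

/-- The control input `u_i` at the augmented state `z`. -/
noncomputable def loopInput : ℝ :=
  loopPI lam1 lam2 z i * Real.cos (loopPI lam1 lam2 z i) * loopErr g z i *
    loopFactor g lam1 lam2 z i

/-- The vector field of the augmented closed loop with graph `g`. -/
noncomputable def loopField : LoopState N :=
  WithLp.toLp 2 fun p => ![b p.1 * loopInput g lam1 lam2 z p.1,
    z (p.1, 0) ^ 2 * loopErr g z p.1 ^ 2, z (p.1, 0) * loopErr g z p.1] p.2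

/-- The augmented state at time zero. -/
noncomputable def loopInit (x₀ : Fin N → ℝ) : LoopState N :=
  WithLp.toLp 2 fun p => ![x₀ p.1, 0, 0] p.2

@[simp] theorem loopField_zero :
    loopField g b lam1 lam2 z (i, 0) = b i * loopInput g lam1 lam2 z i := rfl

@[simp] theorem loopField_one :
    loopField g b lam1 lam2 z (i, 1) = z (i, 0) ^ 2 * loopErr g z i ^ 2 := rfl

@[simp] theorem loopField_two :
    loopField g b lam1 lam2 z (i, 2) = z (i, 0) * loopErr g z i := rfl

@[simp] theorem loopInit_zero (x₀ : Fin N → ℝ) : loopInit x₀ (i, 0) = x₀ i := rfl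

@[simp] theorem loopInit_one (x₀ : Fin N → ℝ) : loopInit x₀ (i, 1) = 0 := rfl

@[simp] theorem loopInit_two (x₀ : Fin N → ℝ) : loopInit x₀ (i, 2) = 0 := rfl

theorem contDiff_loopState_apply (p : Fin N × Fin 3) :
    ContDiff ℝ 1 fun z : LoopState N => z p :=
  contDiff_euclidean.1 contDiff_id p

theorem contDiff_loopErr : ContDiff ℝ 1 fun z => loopErr g z i := by
  have := contDiff_loopState_apply (N := N)
  unfold loopErr
  fun_prop

theorem contDiff_loopPI : ContDiff ℝ 1 fun z => loopPI (N := N) lam1 lam2 z i := by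
  have := contDiff_loopState_apply (N := N)
  unfold loopPI
  fun_prop

theorem contDiff_loopFactor : ContDiff ℝ 1 fun z => loopFactor g lam1 lam2 z i := by
  have := contDiff_loopState_apply (N := N)
  have := contDiff_loopErr g
  unfold loopFactor
  fun_prop

theorem contDiff_loopInput : ContDiff ℝ 1 fun z => loopInput g lam1 lam2 z i := by
  have := contDiff_loopPI (N := N) lam1 lam2
  have := contDiff_loopErr g
  have := contDiff_loopFactor g lam1 lam2
  unfold loopInput
  fun_prop

theorem contDiff_loopField : ContDiff ℝ 1 fun z => loopField g b lam1 lam2 z := by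
  have := contDiff_loopState_apply (N := N)
  have := contDiff_loopErr g
  have := contDiff_loopInput g lam1 lam2
  rw [contDiff_euclidean]
  rintro ⟨i, c⟩
  fin_cases c
  · simp only [Fin.zero_eta, loopField_zero]
    fun_prop
  · simp only [Fin.mk_one, loopField_one]
    fun_prop
  · simp only [Fin.reduceFinMk, loopField_two]
    fun_prop

end Field

/-- Only finitely many graphs are ever active, so constants chosen per graph have a common bound in
time. -/
theorem SwitchingTopologies.exists_forall_le {N M : ℕ} {G : Fin M → WeightedDigraph N} {t : ℕ → ℝ}
    {n : ℕ → Fin M} {Gt : ℝ → WeightedDigraph N} (hG : SwitchingTopologies G t n Gt)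
    {P : WeightedDigraph N → ℝ → Prop} (hmono : ∀ g C C', C ≤ C' → P g C → P g C')
    (hP : ∀ g, ∃ C, P g C) : ∃ C, 0 ≤ C ∧ ∀ s, 0 ≤ s → P (Gt s) C := by
  choose C hC using hP
  obtain ⟨B, hB⟩ := (finite_range fun ℓ => C (G ℓ)).bddAbove
  refine ⟨max B 0, le_max_right _ _, fun s hs => ?_⟩
  obtain ⟨ℓ, hℓ⟩ := hG.exists_eq hs
  rw [hℓ]
  exact hmono _ _ _ ((hB (mem_range_self ℓ)).trans (le_max_left _ _)) (hC _)

theorem SwitchingTopologies.exists_abs_le {N M : ℕ} {G : Fin M → WeightedDigraph N} {t : ℕ → ℝ}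
    {n : ℕ → Fin M} {Gt : ℝ → WeightedDigraph N} (hG : SwitchingTopologies G t n Gt)
    {V : Type*} [TopologicalSpace V] {Φ : WeightedDigraph N → V → ℝ}
    (hΦ : ∀ g, Continuous (Φ g)) {K : Set V} (hK : IsCompact K) :
    ∃ C, 0 ≤ C ∧ ∀ s, 0 ≤ s → ∀ v ∈ K, |Φ (Gt s) v| ≤ C := by
  refine hG.exists_forall_le (P := fun g C => ∀ v ∈ K, |Φ g v| ≤ C)
    (fun g C C' hCC h v hv => (h v hv).trans hCC) fun g => ?_
  obtain ⟨C, hC⟩ := hK.exists_bound_of_continuousOn (hΦ g).continuousOn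
  exact ⟨C, hC⟩

/-- A trajectory on `[0, T]` of the augmented closed loop whose speed is multiplied by `χ`. -/
structure IsLoopTrajectory {N : ℕ} (Gt : ℝ → WeightedDigraph N) (t : ℕ → ℝ) (b : Fin N → ℝ)
    (lam1 lam2 : ℝ) (χ : ℝ → ℝ) (T : ℝ) (z : ℝ → LoopState N) : Prop where
  continuousOn : ContinuousOn z (Icc 0 T)
  hasDerivAt : ∀ s ∈ Ioo 0 T, s ∉ range t →
    HasDerivAt z (χ s • loopField (Gt s) b lam1 lam2 (z s)) s

/-! ### Evolution of the PI term -/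

namespace IsLoopTrajectory

variable {N M : ℕ} {G : Fin M → WeightedDigraph N} {t : ℕ → ℝ} {n : ℕ → Fin M}
  {Gt : ℝ → WeightedDigraph N} {b : Fin N → ℝ} {lam1 lam2 : ℝ} {χ : ℝ → ℝ} {T : ℝ}
  {z : ℝ → LoopState N}

theorem continuousOn_apply (h : IsLoopTrajectory Gt t b lam1 lam2 χ T z) (p : Fin N × Fin 3) :
    ContinuousOn (fun s => z s p) (Icc 0 T) :=
  (contDiff_loopState_apply p).continuous.comp_continuousOn h.continuousOn

theorem hasDerivAt_apply (h : IsLoopTrajectory Gt t b lam1 lam2 χ T z) {s : ℝ} (hs : s ∈ Ioo 0 T)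
    (hst : s ∉ range t) (p : Fin N × Fin 3) :
    HasDerivAt (fun s => z s p) (χ s * loopField (Gt s) b lam1 lam2 (z s) p) s := by
  simpa using hasDerivAt_euclidean.1 (h.hasDerivAt s hs hst) p

/-- The input contains exactly the factor produced by differentiating the two integral terms, so the
derivative factors through a function of `S_i` alone. The speed `χ` only rescales the other factor.
-/
theorem hasDerivAt_loopPI (h : IsLoopTrajectory Gt t b lam1 lam2 χ T z) {s : ℝ}
    (hs : s ∈ Ioo 0 T) (hst : s ∉ range t) (i : Fin N) :
    HasDerivAt (fun s => loopPI lam1 lam2 (z s) i)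
      ((b i * (loopPI lam1 lam2 (z s) i * Real.cos (loopPI lam1 lam2 (z s) i)) + 1) *
        (χ s * (z s (i, 0) * loopErr (Gt s) (z s) i * loopFactor (Gt s) lam1 lam2 (z s) i))) s := by
  have h0 := ((h.hasDerivAt_apply hs hst (i, 0)).fun_pow 2).div_const 2
  have h1 := (h.hasDerivAt_apply hs hst (i, 1)).const_mul lam1
  have h2 := ((h.hasDerivAt_apply hs hst (i, 2)).fun_pow 2).const_mul (lam2 / 2)
  refine ((h0.fun_add h1).fun_add h2).congr_deriv ?_
  simp only [loopField_zero, loopField_one, loopField_two, loopInput, loopFactor]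
  push_cast
  ring

theorem loopPI_lt (h : IsLoopTrajectory Gt t b lam1 lam2 χ T z)
    (hG : SwitchingTopologies G t n Gt) (hT : 0 ≤ T) (hχ : ∀ s ∈ Ioo 0 T, |χ s| ≤ 1) (i : Fin N)
    {c : ℝ} (hc : b i * (c * Real.cos c) + 1 = 0) (h0 : loopPI lam1 lam2 (z 0) i < c) :
    loopPI lam1 lam2 (z T) i < c := by
  have hw : ∀ g : WeightedDigraph N, Continuous fun v : LoopState N =>
      v (i, 0) * loopErr g v i * loopFactor g lam1 lam2 v i := fun g =>
    ((contDiff_loopState_apply (i, 0)).continuous.mul (contDiff_loopErr g i).continuous).mul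
      (contDiff_loopFactor g lam1 lam2 i).continuous
  obtain ⟨C, -, hC⟩ := hG.exists_abs_le hw (isCompact_Icc.image_of_continuousOn h.continuousOn)
  refine lt_of_hasDerivAt_mul_off_finite (S := fun s => loopPI lam1 lam2 (z s) i)
    (g := fun c => b i * (c * Real.cos c) + 1) (W := C) hT
    (finite_range_inter_Ioo hG.tendsto_atTop 0 T) (by fun_prop) hc
    ((contDiff_loopPI lam1 lam2 i).continuous.comp_continuousOn h.continuousOn)
    (fun s hs hst => h.hasDerivAt_loopPI hs hst i) (fun s hs _ => ?_) h0
  rw [abs_mul]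
  have h1 := hC s hs.1.le (z s) (mem_image_of_mem z (Ioo_subset_Icc_self hs))
  exact (mul_le_mul (hχ s hs) h1 (abs_nonneg _) zero_le_one).trans (one_mul C).le

theorem apply_one_nonneg (h : IsLoopTrajectory Gt t b lam1 lam2 χ T z)
    (hG : SwitchingTopologies G t n Gt) (hT : 0 ≤ T) (hχ : ∀ s ∈ Ioo 0 T, 0 ≤ χ s) (i : Fin N)
    (h0 : z 0 (i, 1) = 0) : 0 ≤ z T (i, 1) := by
  rw [← h0]
  refine le_of_deriv_nonneg_off_finite (f := fun s => z s (i, 1)) hT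
    (finite_range_inter_Ioo hG.tendsto_atTop 0 T) (h.continuousOn_apply _)
    (fun s hs hst => h.hasDerivAt_apply hs hst (i, 1)) fun s hs hst => ?_
  rw [loopField_one]
  exact mul_nonneg (hχ s hs) (by positivity)

end IsLoopTrajectory

/-! ### A priori bound, existence and uniqueness for the augmented system -/

section Bounds

variable {N M : ℕ} {G : Fin M → WeightedDigraph N} {t : ℕ → ℝ} {n : ℕ → Fin M}
  {Gt : ℝ → WeightedDigraph N} {b : Fin N → ℝ} {lam1 lam2 : ℝ}

/-- A bound for the augmented trajectories that depends only on the initial state. -/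
theorem exists_loopTrajectory_norm_le (hG : SwitchingTopologies G t n Gt) (hb : ∀ i, b i ≠ 0)
    (h1 : 0 < lam1) (h2 : 0 < lam2) (x₀ : Fin N → ℝ) :
    ∃ R, ∀ (χ : ℝ → ℝ) (T : ℝ) (z : ℝ → LoopState N), 0 ≤ T →
      IsLoopTrajectory Gt t b lam1 lam2 χ T z → (∀ s ∈ Ioo 0 T, χ s ∈ Icc 0 1) →
      z 0 = loopInit x₀ → ‖z T‖ ≤ R := by
  choose c hc hc0 using fun i => exists_gt_mul_cos_eq_zero (hb i) (x₀ i ^ 2 / 2)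
  -- Each nonnegative term of `S_i < c i` is itself below `c i`, which bounds the square of each
  -- coordinate by the listed summand.
  refine ⟨√(∑ p : Fin N × Fin 3,
    ![2 * c p.1, (c p.1 / lam1) ^ 2, 2 * c p.1 / lam2] p.2), fun χ T z hT hz hχ h0 => ?_⟩
  refine Real.le_sqrt_of_sq_le ?_
  rw [EuclideanSpace.real_norm_sq_eq]
  refine Finset.sum_le_sum fun p _ => ?_
  obtain ⟨i, k⟩ := p
  have hS := hz.loopPI_lt hG hT
    (fun s hs => abs_le.2 ⟨by linarith [(hχ s hs).1], (hχ s hs).2⟩) i (hc0 i)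
    (by rw [h0]; simpa [loopPI] using hc i)
  have hη := hz.apply_one_nonneg hG hT (fun s hs => (hχ s hs).1) i (by simp [h0])
  have hci : 0 < c i := lt_of_le_of_lt (by positivity) (hc i)
  unfold loopPI at hS
  have e1 : 0 ≤ lam1 * z T (i, 1) := by positivity
  have e2 : 0 ≤ lam2 / 2 * z T (i, 2) ^ 2 := by positivity
  have e3 := sq_nonneg (z T (i, 0))
  fin_cases k
  · simp only [Fin.zero_eta, Matrix.cons_val_zero]
    linarith
  · simp only [Fin.mk_one, Matrix.cons_val_one, Matrix.cons_val_zero]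
    have : z T (i, 1) ≤ c i / lam1 := by
      rw [le_div_iff₀ h1]
      linarith
    gcongr
  · simp only [Fin.reduceFinMk, Matrix.cons_val]
    rw [le_div_iff₀ h2]
    linarith

/-- A cutoff makes the fields bounded and Lipschitz, hence globally solvable. The cut-off solution
is a trajectory with speed `β (z s)` in `[0, 1]`, so the a priori bound confines it to the ball
where `β = 1`, and it solves the original system. -/
theorem exists_loopTrajectory (hG : SwitchingTopologies G t n Gt) (hb : ∀ i, b i ≠ 0)
    (h1 : 0 < lam1) (h2 : 0 < lam2) (x₀ : Fin N → ℝ) :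
    ∃ z : ℝ → LoopState N, z 0 = loopInit x₀ ∧
      ∀ T, IsLoopTrajectory Gt t b lam1 lam2 (fun _ => 1) T z := by
  obtain ⟨R, hR⟩ := exists_loopTrajectory_norm_le hG hb h1 h2 x₀
  let β : ContDiffBump (0 : LoopState N) :=
    { rIn := max R 1, rOut := max R 1 + 1, rIn_pos := by positivity, rIn_lt_rOut := by linarith }
  have hF : ∀ j, ContDiff ℝ 1 fun z => β z • loopField (G (n j)) b lam1 lam2 z := fun j =>
    β.contDiff.smul (contDiff_loopField _ b lam1 lam2)
  have hFc : ∀ j, HasCompactSupport fun z => β z • loopField (G (n j)) b lam1 lam2 z := fun j =>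
    β.hasCompactSupport.smul_right
  obtain ⟨z, hzc, hz0, hz⟩ := exists_switched_solution hG.strictMono hG.tendsto_atTop
    (f := fun j z => β z • loopField (G (n j)) b lam1 lam2 z)
    (fun j => (hFc j).exists_bound_of_continuous (hF j).continuous)
    (fun j => (hF j).lipschitzWith_of_hasCompactSupport (hFc j) one_ne_zero) (loopInit x₀)
  rw [hG.start] at hzc hz0
  have hχ : ∀ T, IsLoopTrajectory Gt t b lam1 lam2 (fun s => β (z s)) T z := fun T =>
    { continuousOn := hzc.mono fun s hs => hs.1
      hasDerivAt := fun s hs hst => by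
        obtain ⟨j, hj⟩ := hG.exists_mem_Ioo hs.1.le hst
        rw [hG.active j s (Ioo_subset_Ico_self hj)]
        exact hz j s hj }
  have hbound : ∀ s, 0 ≤ s → β (z s) = 1 := fun s hs => by
    refine β.one_of_mem_closedBall ?_
    rw [mem_closedBall_zero_iff]
    exact (hR _ s z hs (hχ s) (fun r _ => ⟨β.nonneg, β.le_one⟩) hz0).trans (le_max_left _ _)
  refine ⟨z, hz0, fun T => ⟨(hχ T).continuousOn, fun s hs hst => ?_⟩⟩
  have := (hχ T).hasDerivAt s hs hst
  simpa only [hbound s hs.1.le] using this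

theorem IsLoopTrajectory.eq {z w : ℝ → LoopState N} {T : ℝ} (hG : SwitchingTopologies G t n Gt)
    (hT : 0 ≤ T) (hz : IsLoopTrajectory Gt t b lam1 lam2 (fun _ => 1) T z)
    (hw : IsLoopTrajectory Gt t b lam1 lam2 (fun _ => 1) T w) (h0 : z 0 = w 0) : z T = w T := by
  obtain ⟨R, hR⟩ := ((isCompact_Icc.image_of_continuousOn hz.continuousOn).union
    (isCompact_Icc.image_of_continuousOn hw.continuousOn)).isBounded.subset_closedBall 0
  obtain ⟨K, -, hK⟩ := hG.exists_forall_le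
    (P := fun g K => ∀ u ∈ Metric.closedBall (0 : LoopState N) R, ∀ v ∈ Metric.closedBall 0 R,
      ‖loopField g b lam1 lam2 u - loopField g b lam1 lam2 v‖ ≤ K * ‖u - v‖)
    (fun g C C' hCC h u hu v hv => (h u hu v hv).trans (by gcongr)) fun g => by
      obtain ⟨K, hK⟩ := ((contDiff_loopField g b lam1 lam2).contDiffOn
        (s := Metric.closedBall 0 R)).locallyLipschitzOn (convex_closedBall 0 R)
        |>.exists_lipschitzOnWith_of_compact (isCompact_closedBall 0 R)
      exact ⟨K, fun u hu v hv => hK.norm_sub_le hu hv⟩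
  refine eq_of_hasDerivAt_off_finite hT (finite_range_inter_Ioo hG.tendsto_atTop 0 T)
    hz.continuousOn hw.continuousOn hz.hasDerivAt hw.hasDerivAt (K := K) (fun s hs _ => ?_) h0
  simp only [one_smul]
  exact hK s hs.1.le _ (hR (Or.inl (mem_image_of_mem z (Ioo_subset_Icc_self hs)))) _
    (hR (Or.inr (mem_image_of_mem w (Ioo_subset_Icc_self hs))))

end Bounds

/-! ### Correspondence between the closed loop and the augmented system -/

section Augmentation

variable {N M : ℕ} {G : Fin M → WeightedDigraph N} {t : ℕ → ℝ} {n : ℕ → Fin M}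
  {Gt : ℝ → WeightedDigraph N} {b : Fin N → ℝ} {lam1 lam2 : ℝ} {x : ℝ → Fin N → ℝ}

/-- The augmented state along `x`. -/
noncomputable def augment (Gt : ℝ → WeightedDigraph N) (x : ℝ → Fin N → ℝ) (s : ℝ) : LoopState N :=
  WithLp.toLp 2 fun p => ![x s p.1, ∫ r in (0 : ℝ)..s, x r p.1 ^ 2 * relErr Gt x p.1 r ^ 2,
    ∫ r in (0 : ℝ)..s, x r p.1 * relErr Gt x p.1 r] p.2

theorem augment_zero (Gt : ℝ → WeightedDigraph N) (x : ℝ → Fin N → ℝ) (s : ℝ) (i : Fin N) :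
    augment Gt x s (i, 0) = x s i := rfl

theorem augment_one (Gt : ℝ → WeightedDigraph N) (x : ℝ → Fin N → ℝ) (s : ℝ) (i : Fin N) :
    augment Gt x s (i, 1) = ∫ r in (0 : ℝ)..s, x r i ^ 2 * relErr Gt x i r ^ 2 := rfl

theorem augment_two (Gt : ℝ → WeightedDigraph N) (x : ℝ → Fin N → ℝ) (s : ℝ) (i : Fin N) :
    augment Gt x s (i, 2) = ∫ r in (0 : ℝ)..s, x r i * relErr Gt x i r := rfl

theorem augment_initial (Gt : ℝ → WeightedDigraph N) (x : ℝ → Fin N → ℝ) :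
    augment Gt x 0 = loopInit (x 0) := by
  ext ⟨i, k⟩
  fin_cases k <;> simp [augment, loopInit]

theorem controlInput_eq_loopInput (i : Fin N) (s : ℝ) :
    controlInput Gt lam1 lam2 x i s = loopInput (Gt s) lam1 lam2 (augment Gt x s) i := rfl

/-- The signal `e_i` at the agent states `v`. -/
noncomputable def stateErr (g : WeightedDigraph N) (i : Fin N) (v : Fin N → ℝ) : ℝ :=
  ∑ k, g.A i k * (v i - v k)

theorem continuous_stateErr (g : WeightedDigraph N) (i : Fin N) :
    Continuous (stateErr g i) := by
  unfold stateErr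
  fun_prop

theorem continuous_sq_mul_stateErr_sq (i : Fin N) (g : WeightedDigraph N) :
    Continuous fun v : Fin N → ℝ => v i ^ 2 * stateErr g i v ^ 2 := by
  have := continuous_stateErr g
  fun_prop

theorem continuous_mul_stateErr (i : Fin N) (g : WeightedDigraph N) :
    Continuous fun v : Fin N → ℝ => v i * stateErr g i v := by
  have := continuous_stateErr g
  fun_prop

theorem isLoopTrajectory_augment (hG : SwitchingTopologies G t n Gt) {T : ℝ} (hT : 0 ≤ T)
    (hx : ContinuousOn x (Icc 0 T)) (hx' : ∀ s ∈ Ioo 0 T, s ∉ range t → ∀ i,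
      HasDerivAt (fun r => x r i) (b i * controlInput Gt lam1 lam2 x i s) s) :
    IsLoopTrajectory Gt t b lam1 lam2 (fun _ => 1) T (augment Gt x) where
  continuousOn := by
    refine (PiLp.continuous_toLp 2 _).comp_continuousOn (continuousOn_pi.2 ?_)
    rintro ⟨i, k⟩
    fin_cases k
    · exact continuousOn_pi.1 hx i
    · exact hG.continuousOn_integral (continuous_sq_mul_stateErr_sq i) hT hx
    · exact hG.continuousOn_integral (continuous_mul_stateErr i) hT hx
  hasDerivAt s hs hst := by
    rw [one_smul, hasDerivAt_euclidean]
    rintro ⟨i, k⟩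
    fin_cases k
    · exact hx' s hs hst i
    · exact hG.hasDerivAt_integral (continuous_sq_mul_stateErr_sq i) hx hs hst
    · exact hG.hasDerivAt_integral (continuous_mul_stateErr i) hx hs hst

/-- The integral components of a trajectory of the augmented closed loop are the integrals along
its agent states. -/
theorem IsLoopTrajectory.augment_eq {z : ℝ → LoopState N} {T : ℝ} {x₀ : Fin N → ℝ}
    (hz : IsLoopTrajectory Gt t b lam1 lam2 (fun _ => 1) T z)
    (hG : SwitchingTopologies G t n Gt) (hT : 0 ≤ T) (h0 : z 0 = loopInit x₀) :
    augment Gt (fun s i => z s (i, 0)) T = z T := by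
  set x : ℝ → Fin N → ℝ := fun s i => z s (i, 0) with hx
  have hxc : ContinuousOn x (Icc 0 T) := continuousOn_pi.2 fun i => hz.continuousOn_apply (i, 0)
  have hfin := finite_range_inter_Ioo hG.tendsto_atTop 0 T
  ext ⟨i, k⟩
  fin_cases k
  · rfl
  -- Both functions have the same derivative, so the Lipschitz constant can be `0`.
  · refine eq_of_hasDerivAt_off_finite (z := fun s => augment Gt x s (i, 1))
      (w := fun s => z s (i, 1)) hT hfin
      (hG.continuousOn_integral (continuous_sq_mul_stateErr_sq i) hT hxc) (hz.continuousOn_apply _)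
      (fun s hs hst => hG.hasDerivAt_integral (continuous_sq_mul_stateErr_sq i) hxc hs hst)
      (fun s hs hst => hz.hasDerivAt_apply hs hst (i, 1)) (K := 0) (fun s hs _ => ?_) ?_
    · rw [loopField_one]
      simp [hx, stateErr, loopErr]
    · simp [augment_one, h0]
  · refine eq_of_hasDerivAt_off_finite (z := fun s => augment Gt x s (i, 2))
      (w := fun s => z s (i, 2)) hT hfin
      (hG.continuousOn_integral (continuous_mul_stateErr i) hT hxc) (hz.continuousOn_apply _)
      (fun s hs hst => hG.hasDerivAt_integral (continuous_mul_stateErr i) hxc hs hst)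
      (fun s hs hst => hz.hasDerivAt_apply hs hst (i, 2)) (K := 0) (fun s hs _ => ?_) ?_
    · rw [loopField_two]
      simp [hx, stateErr, loopErr]
    · simp [augment_two, h0]

theorem exists_closedLoopSolution (hG : SwitchingTopologies G t n Gt) (hb : ∀ i, b i ≠ 0)
    (h1 : 0 < lam1) (h2 : 0 < lam2) (x₀ : Fin N → ℝ) :
    ∃ x : ℝ → Fin N → ℝ, IsClosedLoopSolution Gt t b lam1 lam2 (Ici 0) x ∧ x 0 = x₀ ∧
      ∀ (T : ℝ) (y : ℝ → Fin N → ℝ),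
        IsClosedLoopSolution Gt t b lam1 lam2 (Ico 0 T) y → y 0 = x₀ → EqOn y x (Ico 0 T) := by
  obtain ⟨z, hz0, hz⟩ := exists_loopTrajectory hG hb h1 h2 x₀
  refine ⟨fun s i => z s (i, 0), ⟨?_, fun s hs hst i => ?_⟩, ?_, fun T y hy hy0 s hs => ?_⟩
  · refine continuousOn_pi.2 fun i s hs => ?_
    refine ((hz (s + 1)).continuousOn_apply (i, 0) s ⟨hs, by linarith⟩).mono_of_mem_nhdsWithin ?_
    rw [← Ici_inter_Iic]
    exact inter_mem self_mem_nhdsWithin (mem_nhdsWithin_of_mem_nhds (Iic_mem_nhds (by linarith)))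
  · rw [interior_Ici, mem_Ioi] at hs
    rw [controlInput_eq_loopInput, (hz s).augment_eq hG hs.le hz0]
    simpa using (hz (s + 1)).hasDerivAt_apply ⟨hs, by linarith⟩ hst (i, 0)
  · ext i
    simp [hz0]
  · have hsT : Icc 0 s ⊆ Ico 0 T := fun r hr => ⟨hr.1, hr.2.trans_lt hs.2⟩
    have hya := isLoopTrajectory_augment hG hs.1 (hy.continuousOn.mono hsT) fun r hr hrt i =>
      hy.hasDerivAt r (by rw [interior_Ico]; exact ⟨hr.1, hr.2.trans hs.2⟩) hrt i
    have := hya.eq hG hs.1 (hz s) (by rw [augment_initial, hy0, hz0])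
    ext i
    rw [← augment_zero Gt y s i, this]

end Augmentation

/-! ### Slow variation and consensus -/

/-- If `x x'` tends to zero, then `x` is asymptotically constant on windows of bounded length. -/
theorem eventually_abs_sub_le_of_mul_deriv_tendsto_zero {x x' f : ℝ → ℝ} {D : Set ℝ} {C W : ℝ}
    (hD : ∀ a b, (D ∩ Ioo a b).Finite) (hx : ContinuousOn x (Ici 0))
    (hx' : ∀ s, 0 < s → s ∉ D → HasDerivAt x (x' s) s)
    (hC : ∀ s, 0 < s → |x s * x' s| ≤ C * |f s|) (hf : Tendsto f atTop (𝓝 0)) (hW : 0 < W)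
    {ε : ℝ} (hε : 0 < ε) : ∀ᶠ s in atTop, ∀ r ∈ Icc s (s + W), |x r - x s| ≤ ε := by
  have hμ : 0 < ε ^ 2 / (8 * W) := by positivity
  have hlim : Tendsto (fun s => C * |f s|) atTop (𝓝 0) := by
    simpa using hf.abs.const_mul C
  obtain ⟨s₁, hs₁⟩ := (hlim.eventually_lt_const hμ).exists_forall_of_atTop
  filter_upwards [eventually_ge_atTop s₁, eventually_ge_atTop 0] with s hs hs0 r hr
  have hsq : ∀ p q, s ≤ p → p ≤ q → q ≤ s + W → |x q ^ 2 - x p ^ 2| ≤ ε ^ 2 / 4 := by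
    intro p q hp hpq hq
    have h := abs_sub_le_of_abs_deriv_le_off_finite (f := fun s => x s ^ 2)
      (f' := fun s => 2 * (x s * x' s)) (C := 2 * (ε ^ 2 / (8 * W))) hpq (hD p q)
      ((hx.mono fun u hu => hs0.trans (hp.trans hu.1)).pow 2)
      (fun u hu huD => ((hx' u (by linarith [hu.1]) huD).fun_pow 2).congr_deriv (by simp; ring))
      (fun u hu _ => by
        rw [abs_mul, abs_two]
        have h1 := hC u (by linarith [hu.1])
        have h2 := hs₁ u (by linarith [hu.1])
        linarith)
    calc |x q ^ 2 - x p ^ 2| ≤ 2 * (ε ^ 2 / (8 * W)) * (q - p) := h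
      _ ≤ 2 * (ε ^ 2 / (8 * W)) * W := by gcongr; linarith
      _ = ε ^ 2 / 4 := by field_simp; norm_num
  refine abs_le_of_sq_le_sq ?_ hε.le
  have hrs := abs_le.1 (hsq s r le_rfl hr.1 hr.2)
  -- For equal signs, `(x r - x s)² ≤ |x r ^ 2 - x s ^ 2|`. Otherwise `x` vanishes in between, both
  -- squares are at most `ε² / 4`, and `(x r - x s)² ≤ 2 (x r ^ 2 + x s ^ 2)`.
  by_cases hsign : 0 ≤ x r * x s
  · rcases le_total (x s ^ 2) (x r ^ 2) with h | h
    · have : x s ^ 2 ≤ x r * x s := by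
        refine le_of_sq_le_sq ?_ hsign
        nlinarith [mul_nonneg (sq_nonneg (x s)) (sub_nonneg.2 h)]
      nlinarith
    · have : x r ^ 2 ≤ x r * x s := by
        refine le_of_sq_le_sq ?_ hsign
        nlinarith [mul_nonneg (sq_nonneg (x r)) (sub_nonneg.2 h)]
      nlinarith
  · push Not at hsign
    have hcont : ContinuousOn x (uIcc s r) := by
      rw [uIcc_of_le hr.1]
      exact hx.mono fun u hu => hs0.trans hu.1
    have h0 : (0 : ℝ) ∈ uIcc (x s) (x r) := by
      rw [mem_uIcc]
      rcases mul_neg_iff.1 hsign with h | h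
      · exact Or.inl ⟨h.2.le, h.1.le⟩
      · exact Or.inr ⟨h.1.le, h.2.le⟩
    obtain ⟨q, hq, hq0⟩ := intermediate_value_uIcc hcont h0
    rw [uIcc_of_le hr.1] at hq
    have h1 := abs_le.1 (hsq s q le_rfl hq.1 (hq.2.trans hr.2))
    have h2 := abs_le.1 (hsq q r hq.1 hq.2 hr.2)
    rw [hq0] at h1 h2
    nlinarith [sq_nonneg (x r + x s)]

section Consensus

variable {N M : ℕ} {G : Fin M → WeightedDigraph N} {t : ℕ → ℝ} {n : ℕ → Fin M}
  {Gt : ℝ → WeightedDigraph N}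

/-- By compactness `x` has a limit `c` along every ultrafilter finer than `atTop`. Shifting time to
a nearby activation of each graph does not change `c`, so `c` is an equilibrium for all graphs at
once. -/
theorem SwitchingTopologies.tendsto_sub_of_mul_relErr (hG : SwitchingTopologies G t n Gt)
    {x : ℝ → Fin N → ℝ} {K : Set (Fin N → ℝ)} (hK : IsCompact K) (hxK : ∀ s, 0 ≤ s → x s ∈ K)
    (hslow : ∀ i, ∀ W, 0 < W → ∀ ε, 0 < ε →
      ∀ᶠ s in atTop, ∀ r ∈ Icc s (s + W), |x r i - x s i| ≤ ε)
    (herr : ∀ i, Tendsto (fun s => x s i * relErr Gt x i s) atTop (𝓝 0)) (i k : Fin N) :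
    Tendsto (fun s => x s i - x s k) atTop (𝓝 0) := by
  obtain ⟨W, hW, hwin⟩ := hG.exists_window
  rw [tendsto_iff_ultrafilter]
  intro U hU
  have hxU : Tendsto x U (𝓟 K) :=
    tendsto_principal.2 (hU ((eventually_ge_atTop 0).mono hxK))
  obtain ⟨c, -, hc⟩ := hK.ultrafilter_le_nhds (U.map x) hxU
  have hc : Tendsto x U (𝓝 c) := hc
  have hci : ∀ i, Tendsto (fun s => x s i) U (𝓝 (c i)) := tendsto_pi_nhds.1 hc
  have hzero : ∀ ℓ i, c i * ∑ k, (G ℓ).A i k * (c i - c k) = 0 := by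
    intro ℓ i
    obtain ⟨s₀, hs₀⟩ := hwin ℓ
    -- `ρ s` is a time in `[s, s + W]` at which the active Laplacian is that of `G ℓ`.
    choose! ρ hρ hlap using hs₀
    have hρtop : Tendsto ρ atTop atTop :=
      tendsto_atTop_mono' _ ((eventually_ge_atTop s₀).mono fun s hs => (hρ s hs).1) tendsto_id
    have hρc : ∀ j, Tendsto (fun s => x (ρ s) j) U (𝓝 (c j)) := by
      intro j
      have hd : Tendsto (fun s => x (ρ s) j - x s j) atTop (𝓝 0) := by
        rw [Metric.tendsto_nhds]
        intro ε hε
        filter_upwards [hslow j W hW (ε / 2) (by positivity), eventually_ge_atTop s₀] with s hs hs0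
        rw [Real.dist_eq, sub_zero]
        linarith [hs (ρ s) (hρ s hs0)]
      simpa using (hd.mono_left hU).add (hci j)
    have hl1 : Tendsto (fun s => x (ρ s) i * ∑ k, (G ℓ).A i k * (x (ρ s) i - x (ρ s) k)) U
        (𝓝 (c i * ∑ k, (G ℓ).A i k * (c i - c k))) :=
      (hρc i).mul (tendsto_finsetSum _ fun k _ => ((hρc i).sub (hρc k)).const_mul _)
    have hl2 : Tendsto (fun s => x (ρ s) i * ∑ k, (G ℓ).A i k * (x (ρ s) i - x (ρ s) k)) U
        (𝓝 0) := by
      refine (((herr i).comp hρtop).mono_left hU).congr' ?_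
      filter_upwards [hU (eventually_ge_atTop s₀)] with s hs
      simp only [Function.comp_apply, relErr, WeightedDigraph.sum_mul_sub_eq_laplacian_mulVec,
        hlap s hs]
    exact tendsto_nhds_unique hl1 hl2
  have := (hci i).sub (hci k)
  rwa [hG.basis.eq_of_mul_eq_zero hzero i k, sub_self] at this

end Consensus

/-! ### Decay of `x_i e_i` along bounded trajectories -/

section Convergence

variable {N M : ℕ} {G : Fin M → WeightedDigraph N} {t : ℕ → ℝ} {n : ℕ → Fin M}
  {Gt : ℝ → WeightedDigraph N} {b : Fin N → ℝ} {lam1 lam2 : ℝ} {R : ℝ}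

theorem contDiff_mul_loopErr (i : Fin N) (g : WeightedDigraph N) :
    ContDiff ℝ 1 fun v : LoopState N => v (i, 0) * loopErr g v i :=
  (contDiff_loopState_apply (i, 0)).mul (contDiff_loopErr g i)

/-- The coordinate `(i, 1)` is a bounded primitive of the square of this signal, and between
switches its derivative is bounded on the ball, so the Barbalat variant applies. -/
theorem tendsto_mul_loopErr (hG : SwitchingTopologies G t n Gt) {z : ℝ → LoopState N}
    (hzc : ContinuousOn z (Ici 0))
    (hzd : ∀ s, 0 < s → s ∉ range t → HasDerivAt z (loopField (Gt s) b lam1 lam2 (z s)) s)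
    (hzR : ∀ s, 0 ≤ s → z s ∈ Metric.closedBall 0 R) (i : Fin N) :
    Tendsto (fun s => z s (i, 0) * loopErr (Gt s) (z s) i) atTop (𝓝 0) := by
  have hcompact := isCompact_closedBall (0 : LoopState N) R
  obtain ⟨τ, hτ, hdw⟩ := hG.dwell
  obtain ⟨K, hK0, hK⟩ := hG.exists_abs_le (Φ := fun g v =>
    fderiv ℝ (fun v : LoopState N => v (i, 0) * loopErr g v i) v (loopField g b lam1 lam2 v))
    (fun g => ((contDiff_mul_loopErr i g).continuous_fderiv one_ne_zero).clm_apply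
      (contDiff_loopField g b lam1 lam2).continuous) hcompact
  obtain ⟨C, -, hC⟩ := hG.exists_abs_le (Φ := fun _ (v : LoopState N) => v (i, 1))
    (fun _ => (contDiff_loopState_apply (i, 1)).continuous) hcompact
  have hlip : ∀ j, ∀ r ∈ Ico (t j) (t (j + 1)), ∀ s ∈ Ico (t j) (t (j + 1)), r ≤ s →
      |z s (i, 0) * loopErr (Gt s) (z s) i - z r (i, 0) * loopErr (Gt r) (z r) i| ≤ (K + 1) * (s - r) := by
    intro j r hr s hs hrs
    have hr0 : 0 ≤ r := (hG.nonneg j).trans hr.1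
    -- With the graph frozen at `G (n j)` the signal is differentiable inside the interval without
    -- exceptional times.
    have h := abs_sub_le_of_abs_deriv_le_off_finite (D := ∅)
      (f := fun s => z s (i, 0) * loopErr (G (n j)) (z s) i)
      (f' := fun s => fderiv ℝ (fun v : LoopState N => v (i, 0) * loopErr (G (n j)) v i) (z s)
        (loopField (G (n j)) b lam1 lam2 (z s))) (C := K) hrs (by simp)
      ((contDiff_mul_loopErr i (G (n j))).continuous.comp_continuousOn
        (hzc.mono fun u hu => hr0.trans hu.1))
      (fun u hu _ => by
        have hj : u ∈ Ioo (t j) (t (j + 1)) := ⟨hr.1.trans_lt hu.1, hu.2.trans hs.2⟩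
        have hut : u ∉ range t := by
          rintro ⟨m, rfl⟩
          have h1 := hG.strictMono.lt_iff_lt.1 hj.1
          have h2 := hG.strictMono.lt_iff_lt.1 hj.2
          omega
        have hd := hzd u (hr0.trans_lt hu.1) hut
        rw [hG.active j u (Ioo_subset_Ico_self hj)] at hd
        exact (((contDiff_mul_loopErr i (G (n j))).differentiable one_ne_zero) (z u)).hasFDerivAt.comp_hasDerivAt
          u hd)
      (fun u hu _ => by
        have hu0 : 0 ≤ u := hr0.trans hu.1.le
        have := hK u hu0 (z u) (hzR u hu0)
        rwa [hG.active j u ⟨hr.1.trans hu.1.le, hu.2.trans hs.2⟩] at this)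
    have hval : ∀ u ∈ Ico (t j) (t (j + 1)),
        z u (i, 0) * loopErr (Gt u) (z u) i = z u (i, 0) * loopErr (G (n j)) (z u) i := fun u hu => by
      rw [hG.active j u hu]
    rw [hval s hs, hval r hr]
    exact h.trans (by gcongr; linarith)
  refine tendsto_zero_of_bounded_primitive_sq hG.start hτ hdw (η := fun s => z s (i, 1))
    (K := K + 1) (C := C) (by positivity) (fun j r hr s hs => ?_)
    ((contDiff_loopState_apply (i, 1)).continuous.comp_continuousOn hzc) (fun s hs hst => ?_)
    (fun s hs => (le_abs_self _).trans (hC s hs _ (hzR s hs)))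
  · rcases le_total r s with h | h
    · rw [abs_sub_comm, abs_sub_comm r, abs_of_nonneg (sub_nonneg.2 h)]
      exact hlip j r hr s hs h
    · rw [abs_of_nonneg (sub_nonneg.2 h)]
      exact hlip j s hs r hr h
  · refine (hasDerivAt_euclidean.1 (hzd s hs hst) (i, 1)).congr_deriv ?_
    rw [loopField_one, mul_pow]

/-- `x_i x_i'` equals `x_i e_i` times `b_i S_i cos S_i` and the PI factor, which are bounded on the
ball. -/
theorem eventually_abs_sub_le_of_loopTrajectory (hG : SwitchingTopologies G t n Gt)
    {z : ℝ → LoopState N} (hzc : ContinuousOn z (Ici 0))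
    (hzd : ∀ s, 0 < s → s ∉ range t → HasDerivAt z (loopField (Gt s) b lam1 lam2 (z s)) s)
    (hzR : ∀ s, 0 ≤ s → z s ∈ Metric.closedBall 0 R) (i : Fin N) {W : ℝ} (hW : 0 < W) {ε : ℝ}
    (hε : 0 < ε) : ∀ᶠ s in atTop, ∀ r ∈ Icc s (s + W), |z r (i, 0) - z s (i, 0)| ≤ ε := by
  obtain ⟨C, -, hC⟩ := hG.exists_abs_le (Φ := fun g (v : LoopState N) =>
    b i * (loopPI lam1 lam2 v i * Real.cos (loopPI lam1 lam2 v i) *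
      loopFactor g lam1 lam2 v i))
    (fun g => by
      have h1 := (contDiff_loopPI (N := N) lam1 lam2 i).continuous
      have h2 := (contDiff_loopFactor g lam1 lam2 i).continuous
      fun_prop) (isCompact_closedBall (0 : LoopState N) R)
  refine eventually_abs_sub_le_of_mul_deriv_tendsto_zero (C := C) (x := fun s => z s (i, 0))
    (finite_range_inter_Ioo hG.tendsto_atTop)
    ((contDiff_loopState_apply (i, 0)).continuous.comp_continuousOn hzc)
    (fun s hs hst => hasDerivAt_euclidean.1 (hzd s hs hst) (i, 0)) (fun s hs => ?_)
    (tendsto_mul_loopErr hG hzc hzd hzR i) hW hε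
  refine le_trans (le_of_eq ?_)
    (mul_le_mul_of_nonneg_right (hC s hs.le (z s) (hzR s hs.le)) (abs_nonneg _))
  rw [← abs_mul, loopField_zero, loopInput]
  congr 1
  ring

end Convergence

/-! ### The main theorem -/

theorem theorem1 {N M : ℕ} (G : Fin M → WeightedDigraph N) (t : ℕ → ℝ) (n : ℕ → Fin M)
    (Gt : ℝ → WeightedDigraph N) (hG : SwitchingTopologies G t n Gt)
    (b : Fin N → ℝ) (hb : ∀ i, b i ≠ 0)
    (lam1 lam2 : ℝ) (hlam1 : 0 < lam1) (hlam2 : 0 < lam2) (x0 : Fin N → ℝ) :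
    (∃ x : ℝ → Fin N → ℝ, IsClosedLoopSolution Gt t b lam1 lam2 (Ici 0) x ∧ x 0 = x0 ∧
      ∀ (T : ℝ) (y : ℝ → Fin N → ℝ),
        IsClosedLoopSolution Gt t b lam1 lam2 (Ico 0 T) y → y 0 = x0 → EqOn y x (Ico 0 T)) ∧
    (∀ x : ℝ → Fin N → ℝ, IsClosedLoopSolution Gt t b lam1 lam2 (Ici 0) x → x 0 = x0 →
      (∀ i, ∃ C : ℝ, ∀ s, 0 ≤ s → |x s i| ≤ C) ∧
      (∀ i, ∃ C : ℝ, ∀ s, 0 ≤ s → |controlInput Gt lam1 lam2 x i s| ≤ C) ∧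
      (∀ i k, Tendsto (fun s => x s i - x s k) atTop (𝓝 0))) := by
  refine ⟨exists_closedLoopSolution hG hb hlam1 hlam2 x0, fun x hx hx0 => ?_⟩
  set z := augment Gt x with hzdef
  have hz : ∀ T, 0 ≤ T → IsLoopTrajectory Gt t b lam1 lam2 (fun _ => 1) T z := fun T hT =>
    isLoopTrajectory_augment hG hT (hx.continuousOn.mono fun s hs => hs.1) fun s hs hst i =>
      hx.hasDerivAt s (by rw [interior_Ici]; exact hs.1) hst i
  have hzc : ContinuousOn z (Ici 0) := fun s hs => by
    refine ((hz (s + 1) (by linarith [mem_Ici.1 hs])).continuousOn s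
      ⟨hs, by linarith⟩).mono_of_mem_nhdsWithin ?_
    rw [← Ici_inter_Iic]
    exact inter_mem self_mem_nhdsWithin (mem_nhdsWithin_of_mem_nhds (Iic_mem_nhds (by linarith)))
  have hzd : ∀ s, 0 < s → s ∉ range t → HasDerivAt z (loopField (Gt s) b lam1 lam2 (z s)) s :=
    fun s hs hst => by
      simpa using (hz (s + 1) (by linarith)).hasDerivAt s ⟨hs, by linarith⟩ hst
  obtain ⟨R, hR⟩ := exists_loopTrajectory_norm_le hG hb hlam1 hlam2 x0
  have hzR : ∀ s, 0 ≤ s → z s ∈ Metric.closedBall 0 R := fun s hs => by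
    rw [mem_closedBall_zero_iff]
    exact hR _ s z hs (hz s hs) (fun _ _ => ⟨zero_le_one, le_rfl⟩)
      (by rw [hzdef, augment_initial, hx0])
  have hcompact := isCompact_closedBall (0 : LoopState N) R
  refine ⟨fun i => ?_, fun i => ?_, ?_⟩
  · obtain ⟨C, -, hC⟩ := hG.exists_abs_le (Φ := fun _ (v : LoopState N) => v (i, 0))
      (fun _ => (contDiff_loopState_apply (i, 0)).continuous) hcompact
    refine ⟨C, fun s hs => ?_⟩
    rw [← augment_zero Gt x s i]
    exact hC s hs (z s) (hzR s hs)
  · obtain ⟨C, -, hC⟩ := hG.exists_abs_le (Φ := fun g v => loopInput g lam1 lam2 v i)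
      (fun g => (contDiff_loopInput g lam1 lam2 i).continuous) hcompact
    refine ⟨C, fun s hs => ?_⟩
    rw [controlInput_eq_loopInput]
    exact hC s hs (z s) (hzR s hs)
  · have hproj : Continuous fun (v : LoopState N) i => v (i, 0) :=
      continuous_pi fun i => (contDiff_loopState_apply (i, 0)).continuous
    exact hG.tendsto_sub_of_mul_relErr (hcompact.image hproj)
      (fun s hs => mem_image_of_mem (fun (v : LoopState N) i => v (i, 0)) (hzR s hs))
      (fun i W hW ε hε => eventually_abs_sub_le_of_loopTrajectory hG hzc hzd hzR i hW hε)
      (tendsto_mul_loopErr hG hzc hzd hzR)
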